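/- Let $\sigma$ be the Fibonacci morphism $a\mapsto ab$, $b\mapsto a$ on words over $\{a,b\}$, let $\mathbb{F}=x_1x_2x_3\cdots=abaababa\cdots$ be its fixed point beginning with $a$, and write $\mathbb{F}[1,n]=x_1x_2\cdots x_n$. Put $F_{-1}=b$, $F_m=\sigma^m(a)$ for $m\ge 0$, and let $f_m=|F_m|$, so that $f_{-1}=f_0=1$ and $f_{m+1}=f_m+f_{m-1}$ for $m\ge 0$. Let $\delta_m$ be the last letter of $F_m$, and for $m\ge -1$ let $K_m=\delta_{m+1}F_m\delta_m^{-1}$ be the $m$-th singular word, that is, the word obtained from $F_m$ by deleting its last letter and putting the letter $\delta_{m+1}$ in front. Let $\mathcal{P}$ be the set of all nonempty palindromes that occur in $\mathbb{F}$. For $\omega\in\mathcal{P}$ let $\mathrm{Ker}(\omega)$, the kernel of $\omega$, be the maximal singular word occurring in $\omega$, that is, $K_j$ for the largest $j\ge -1$ such that $K_j$ is a factor of $\omega$. Let $\phi=\frac{\sqrt5-1}{2}$, and write $\omega\triangleright u$ if $\omega$ is a suffix of $u$. Then for all integers $m\ge -1$, $p\ge 1$ and $1\le i\le f_{m+1}$,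 $$\{\omega\in\mathcal{P}:\ \omega\triangleright\mathbb{F}[1,f_{m+2}+i-2]\}$$ $$=\{\omega\in\mathcal{P}:\ \omega\triangleright\mathbb{F}[1,\,pf_{m+1}+(\lfloor\phi p\rfloor+1)f_m+i-2],\ \mathrm{Ker}(\omega)=K_j\text{ for some }-1\le j\le m\}.$$ -/

import Mathlib

namespace FibPal

/-- The binary alphabet `{a, b}`. -/
inductive Letter
  | a
  | b
  deriving DecidableEq

open Letter

/-- Finite words over `{a, b}`. -/
abbrev Word := List Letter

/-- The Fibonacci morphism on letters: `a ↦ ab`, `b ↦ a`. -/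
def sigmaLetter : Letter → Word
  | a => [a, b]
  | b => [a]

/-- The Fibonacci morphism `σ` on words. -/
def sigma (w : Word) : Word := w.flatMap sigmaLetter

/-- `F_m` for `m ≥ -1`: `F_{-1} = b` and `F_m = σ^m(a)` for `m ≥ 0`. As `σ(b) = a`, this is
`σ^(m+1)(b)`; see `finWord_neg_one` and `finWord_natCast`. Only `m ≥ -1` is meaningful. -/
def finWord (m : ℤ) : Word := sigma^[(m + 1).toNat] [b]

/-- The Fibonacci numbers with `f_{-1} = f_0 = 1` and `f_{m+1} = f_m + f_{m-1}` for `m ≥ 0`;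
see `f_neg_one`, `f_zero`, `f_add_one`. Only `m ≥ -1` is meaningful. -/
def f (m : ℤ) : ℕ := Nat.fib (m + 2).toNat

/-- `δ_m`, the last letter of the (nonempty) word `F_m`; see `finWord_eq_dropLast_append`. -/
def lastLetter (m : ℤ) : Letter := (finWord m).getLastD a

/-- The singular word `K_m = δ_{m+1} F_m δ_m⁻¹` for `m ≥ -1`
(put `δ_{m+1}` in front of `F_m` and delete the last letter `δ_m`). -/
def singularWord (m : ℤ) : Word := lastLetter (m + 1) :: (finWord m).dropLast

/-- The infinite Fibonacci sequence, with letters numbered from `0`: letter `n` is the letter with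
that number of `F_k = σ^k(a)` for any large `k`, and `k = n` is large enough. It is the
fixed point of `σ` beginning with `a`: see `fibSeq_zero` and `sigma_fibFactor`. -/
def fibSeq (n : ℕ) : Letter := (sigma^[n] [a]).getD n a

/-- `𝔽[i, j] = x_i x_{i+1} ⋯ x_j`, for `1 ≤ i`, where the letters `x_1 x_2 ⋯` of the Fibonacci
sequence are numbered from `1`; it is empty if `j < i`. -/
def fibFactor (i j : ℕ) : Word := (List.range (j + 1 - i)).map fun k => fibSeq (i - 1 + k)

/-- The set `𝒫` of all (nonempty) palindromes that occur in the Fibonacci sequence. -/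
def palindromes : Set Word :=
  {w | w = w.reverse ∧ ∃ i j : ℕ, 1 ≤ i ∧ i ≤ j ∧ w = fibFactor i j}

/-- `Ker(w) = k`: the word `k` is the maximal singular word occurring in `w`, that is, `k = K_j`
for the largest `j ≥ -1` such that `K_j` is a factor of `w`. (The lengths `f_j` of the
words `K_j` strictly increase with `j ≥ 0`; between `K_{-1} = a` and `K_0 = b`, of
the same length, `b` is the larger: `Ker(aba) = b`.) -/
def IsKernel (w k : Word) : Prop :=
  ∃ j : ℤ, IsGreatest {l : ℤ | -1 ≤ l ∧ singularWord l <:+: w} j ∧ k = singularWord j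

/-- `φ = (√5 - 1) / 2`. -/
noncomputable def phi : ℝ := (Real.sqrt 5 - 1) / 2

/-! Checks that the definitions are the intended ones. -/

theorem finWord_neg_one : finWord (-1) = [b] := rfl

theorem finWord_natCast (n : ℕ) : finWord n = sigma^[n] [a] := by
  have h : ((n : ℤ) + 1).toNat = n + 1 := by omega
  rw [finWord, h, Function.iterate_succ_apply]
  rfl

theorem f_neg_one : f (-1) = 1 := rfl

theorem f_zero : f 0 = 1 := rfl

theorem f_add_one (m : ℤ) (hm : 0 ≤ m) : f (m + 1) = f m + f (m - 1) := by
  obtain ⟨n, rfl⟩ := Int.eq_ofNat_of_zero_le hm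
  have h1 : ((n : ℤ) + 1 + 2).toNat = n + 1 + 2 := by omega
  have h2 : ((n : ℤ) + 2).toNat = n + 1 + 1 := by omega
  have h3 : ((n : ℤ) - 1 + 2).toNat = n + 1 := by omega
  simp only [f, h1, h2, h3]
  rw [Nat.fib_add_two, add_comm]

theorem sigma_append (v w : Word) : sigma (v ++ w) = sigma v ++ sigma w := List.flatMap_append

theorem iterate_sigma_append (n : ℕ) (v w : Word) :
    sigma^[n] (v ++ w) = sigma^[n] v ++ sigma^[n] w := by
  induction n generalizing v w with
  | zero => rfl
  | succ n ih => simp only [Function.iterate_succ_apply, sigma_append, ih]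

theorem iterate_sigma_succ (n : ℕ) :
    sigma^[n + 1] [a] = sigma^[n] [a] ++ sigma^[n] [b] := by
  rw [Function.iterate_succ_apply, ← iterate_sigma_append]
  rfl

theorem length_finWord (m : ℤ) (hm : -1 ≤ m) : (finWord m).length = f m := by
  obtain ⟨n, hn⟩ := Int.eq_ofNat_of_zero_le (show 0 ≤ m + 1 by omega)
  have h2 : (m + 2).toNat = n + 1 := by omega
  simp only [finWord, f, hn, h2, Int.toNat_natCast]
  clear hn h2 hm
  induction n using Nat.twoStepInduction with
  | zero => rfl
  | one => rfl
  | more n ih1 ih2 =>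
    have h3 : sigma^[n + 2] [b] = sigma^[n + 1] [b] ++ sigma^[n] [b] := by
      have h4 : ∀ k, sigma^[k + 1] [b] = sigma^[k] [a] := fun k => by
        rw [Function.iterate_succ_apply]; rfl
      rw [h4, iterate_sigma_succ, h4]
    rw [h3, List.length_append, ih1, ih2, Nat.fib_add_two (n := n + 1), add_comm]

theorem finWord_eq_dropLast_append (m : ℤ) (hm : -1 ≤ m) :
    finWord m = (finWord m).dropLast ++ [lastLetter m] := by
  have h : finWord m ≠ [] := by
    intro h
    have h1 := length_finWord m hm
    rw [h, f] at h1
    have h2 : 0 < Nat.fib (m + 2).toNat := Nat.fib_pos.2 (by omega)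
    simp only [List.length_nil] at h1
    omega
  rw [lastLetter, List.getLastD_eq_getLast?, List.getLast?_eq_some_getLast h]
  exact (List.dropLast_append_getLast h).symm

theorem lt_length_iterate (n : ℕ) : n < (sigma^[n] [a]).length := by
  rw [← finWord_natCast, length_finWord _ (by omega), f]
  have h : ((n : ℤ) + 2).toNat = n + 2 := by omega
  rw [h]
  induction n with
  | zero => decide
  | succ n ih =>
    have h1 := Nat.fib_add_two (n := n + 1)
    have h2 : 0 < Nat.fib (n + 1) := Nat.fib_pos.2 (by omega)
    have h3 := ih (by omega)
    have h4 : n + 1 + 2 = n + 3 := rfl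
    have h5 : n + 1 + 1 = n + 2 := rfl
    simp only [h5, h4] at *
    omega

theorem iterate_prefix {n k : ℕ} (h : n ≤ k) : sigma^[n] [a] <+: sigma^[k] [a] := by
  induction k, h using Nat.le_induction with
  | base => exact List.prefix_refl _
  | succ k _ ih => exact ih.trans ⟨_, (iterate_sigma_succ k).symm⟩

theorem fibSeq_eq_getElem (n k : ℕ) (h : n < (sigma^[k] [a]).length) :
    fibSeq n = (sigma^[k] [a])[n] := by
  have h1 := lt_length_iterate n
  rw [fibSeq, List.getD_eq_getElem _ _ h1]
  rcases le_total n k with hk | hk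
  · exact (iterate_prefix hk).getElem h1
  · exact ((iterate_prefix hk).getElem h).symm

theorem length_fibFactor_one (n : ℕ) : (fibFactor 1 n).length = n := by simp [fibFactor]

theorem eq_fibFactor_of_prefix {w : Word} {k : ℕ} (h : w <+: sigma^[k] [a]) :
    w = fibFactor 1 w.length := by
  apply List.ext_getElem (length_fibFactor_one _).symm
  intro n h1 h2
  have h3 : n < (sigma^[k] [a]).length := lt_of_lt_of_le h1 h.length_le
  simp only [fibFactor, List.getElem_map, List.getElem_range, Nat.sub_self, Nat.zero_add]
  rw [fibSeq_eq_getElem n k h3]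
  exact h.getElem h1

theorem fibFactor_prefix (n : ℕ) : fibFactor 1 n <+: sigma^[n] [a] := by
  have h : ((sigma^[n] [a]).take n).length = n := by
    rw [List.length_take]
    exact min_eq_left (lt_length_iterate n).le
  have h1 := eq_fibFactor_of_prefix (List.take_prefix n (sigma^[n] [a]))
  rw [h] at h1
  rw [← h1]
  exact List.take_prefix _ _

/-- The Fibonacci sequence begins with `a`. -/
theorem fibSeq_zero : fibSeq 0 = a := rfl

/-- The Fibonacci sequence is fixed by `σ`: the image of a prefix is a prefix. -/
theorem sigma_fibFactor (n : ℕ) :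
    sigma (fibFactor 1 n) = fibFactor 1 (sigma (fibFactor 1 n)).length := by
  obtain ⟨t, ht⟩ := fibFactor_prefix n
  apply eq_fibFactor_of_prefix (k := n + 1)
  rw [Function.iterate_succ_apply', ← ht, sigma_append]
  exact List.prefix_append _ _

end FibPal

namespace FibPal

open Letter

/-! Put n = m + 1, q = p - 1 and l = f_{m+2} + i - 2. Since 𝔽 is fixed by σ, it is a product of
blocks σⁿ(a) and σⁿ(b), and the longer prefix factors as σⁿ(σ(𝔽[1,q])) followed by 𝔽[1,l]
(`fibFactor_eq_append`). The length is right because σ(𝔽[1,q]) has q letters a and ⌊φp⌋ letters b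
(`count_a_fibFactor`). The tail is right because aba or aab follows σ(𝔽[1,q]), and the images of
both under σⁿ begin with 𝔽[1,l].

It remains to see that kernels of index at most m single out the suffixes that stay inside this
tail. The tail contains no K_j with j > m: it lies in F_j F_j F_j, whose factors of length f_j are
conjugates of F_j, while K_j has other letter counts (`not_singularWord_infix_fibFactor`). A longer
suffix contains the last letter of the preceding block followed by 𝔽[1,l], hence K_n or K_{n+1}
(`exists_singularWord_infix`). Of palindromes, only nonemptiness is used. -/

/-! ### Recurrences, last letters and singular words. -/

theorem iterate_sigma_b_succ (n : ℕ) : sigma^[n + 1] [b] = sigma^[n] [a] := by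
  rw [Function.iterate_succ_apply]; rfl

theorem iterate_sigma_b_add_two (n : ℕ) :
    sigma^[n + 2] [b] = sigma^[n + 1] [b] ++ sigma^[n] [b] := by
  rw [iterate_sigma_b_succ, iterate_sigma_succ, iterate_sigma_b_succ]

theorem finWord_natCast_sub_one (n : ℕ) : finWord ((n : ℤ) - 1) = sigma^[n] [b] := by
  simp [finWord]

theorem finWord_add_two (m : ℤ) (hm : -1 ≤ m) :
    finWord (m + 2) = finWord (m + 1) ++ finWord m := by
  obtain ⟨n, hn⟩ := Int.eq_ofNat_of_zero_le (show 0 ≤ m + 1 by omega)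
  obtain rfl : m = (n : ℤ) - 1 := by omega
  rw [show (n : ℤ) - 1 + 2 = ((n + 2 : ℕ) : ℤ) - 1 by push_cast; ring,
    show (n : ℤ) - 1 + 1 = ((n + 1 : ℕ) : ℤ) - 1 by push_cast; ring]
  simp only [finWord_natCast_sub_one]
  exact iterate_sigma_b_add_two n

theorem f_add_two (m : ℤ) (hm : -1 ≤ m) : f (m + 2) = f (m + 1) + f m := by
  have h := congrArg List.length (finWord_add_two m hm)
  rwa [List.length_append, length_finWord _ (by omega), length_finWord _ (by omega),
    length_finWord _ hm] at h

theorem f_pos (m : ℤ) (hm : -1 ≤ m) : 0 < f m := Nat.fib_pos.2 (by omega)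

theorem f_le_f {m l : ℤ} (h : m ≤ l) : f m ≤ f l := Nat.fib_mono (by omega)

theorem f_lt_f {m l : ℤ} (hm : 0 ≤ m) (h : m < l) : f m < f l :=
  (Nat.fib_lt_fib (by omega)).2 (by omega)

theorem lastLetter_add_two (m : ℤ) (hm : -1 ≤ m) : lastLetter (m + 2) = lastLetter m := by
  have h := finWord_add_two m hm
  rw [finWord_eq_dropLast_append (m + 2) (by omega), finWord_eq_dropLast_append m hm,
    ← List.append_assoc] at h
  simpa using (List.append_inj' h rfl).2

theorem lastLetter_add_one_ne (m : ℤ) (hm : -1 ≤ m) : lastLetter (m + 1) ≠ lastLetter m := by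
  induction m, hm using Int.leInduction with
  | base => decide
  | succ m hm ih =>
    rw [show m + 1 + 1 = m + 2 by ring, lastLetter_add_two m hm]
    exact ih.symm

theorem length_singularWord (m : ℤ) (hm : -1 ≤ m) : (singularWord m).length = f m := by
  have h := f_pos m hm
  rw [singularWord, List.length_cons, List.length_dropLast, length_finWord m hm]
  omega

theorem singularWord_injOn : Set.InjOn singularWord {m | -1 ≤ m} := by
  have key : ∀ m l : ℤ, -1 ≤ m → m < l → singularWord m ≠ singularWord l := by
    intro m l hm hl h
    have hlen := congrArg List.length h
    rw [length_singularWord m hm, length_singularWord l (by omega)] at hlen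
    rcases eq_or_lt_of_le hm with rfl | hm'
    · rcases eq_or_lt_of_le (show 0 ≤ l by omega) with rfl | hl'
      -- Lengths separate all pairs but this one: K_{-1} = a and K_0 = b.
      · revert h; decide
      · have := f_lt_f le_rfl hl'
        rw [f_zero] at this
        rw [f_neg_one] at hlen
        omega
    · exact (f_lt_f (by omega) hl).ne hlen
  intro m hm l hl h
  rcases lt_trichotomy m l with h' | h' | h'
  · exact (key m l hm h' h).elim
  · exact h'
  · exact (key l m hl h' h.symm).elim

/-- Trading δ_m for the different letter δ_{m+1} changes the letter counts, so K_m is not a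
conjugate of F_m. -/
theorem count_singularWord_lt (m : ℤ) (hm : -1 ≤ m) :
    (finWord m).count (lastLetter (m + 1)) < (singularWord m).count (lastLetter (m + 1)) := by
  have h := lastLetter_add_one_ne m hm
  rw [finWord_eq_dropLast_append m hm, singularWord, List.count_append, List.count_cons_self,
    List.count_singleton]
  simp [h.symm]

/-! ### Prefixes of the Fibonacci sequence. -/

/-- A word is a prefix of the Fibonacci sequence. -/
def IsFibPrefix (w : Word) : Prop := ∃ k, w <+: sigma^[k] [a]

namespace IsFibPrefix

variable {v w : Word}

theorem eq_fibFactor (h : IsFibPrefix w) : w = fibFactor 1 w.length :=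
  eq_fibFactor_of_prefix h.choose_spec

theorem of_prefix (h : IsFibPrefix w) (hv : v <+: w) : IsFibPrefix v :=
  ⟨h.choose, hv.trans h.choose_spec⟩

theorem prefix_of_length_le (hv : IsFibPrefix v) (hw : IsFibPrefix w)
    (h : v.length ≤ w.length) : v <+: w := by
  obtain ⟨k, hk⟩ := hv
  obtain ⟨l, hl⟩ := hw
  exact List.prefix_of_prefix_length_le (hk.trans (iterate_prefix (le_max_left k l)))
    (hl.trans (iterate_prefix (le_max_right k l))) h

theorem iterate_sigma (h : IsFibPrefix w) (n : ℕ) : IsFibPrefix (sigma^[n] w) := by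
  obtain ⟨k, t, ht⟩ := h
  refine ⟨n + k, sigma^[n] t, ?_⟩
  rw [← iterate_sigma_append, ht, ← Function.iterate_add_apply]

end IsFibPrefix

theorem isFibPrefix_fibFactor (n : ℕ) : IsFibPrefix (fibFactor 1 n) := ⟨n, fibFactor_prefix n⟩

theorem isFibPrefix_finWord (m : ℤ) (hm : 0 ≤ m) : IsFibPrefix (finWord m) := by
  obtain ⟨n, rfl⟩ := Int.eq_ofNat_of_zero_le hm
  exact ⟨n, by rw [← finWord_natCast]⟩

/-! ### Letter counts under σ and the slope φ. -/

theorem count_a_sigma (w : Word) : (sigma w).count a = w.length := by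
  induction w with
  | nil => rfl
  | cons x w ih =>
    rw [← List.singleton_append, sigma_append, List.count_append, ih]
    cases x <;> simp [sigma, sigmaLetter, add_comm]

theorem count_b_sigma (w : Word) : (sigma w).count b = w.count a := by
  induction w with
  | nil => rfl
  | cons x w ih =>
    rw [← List.singleton_append, sigma_append, List.count_append, List.count_append, ih]
    cases x <;> simp [sigma, sigmaLetter]

theorem count_a_add_count_b (w : Word) : w.count a + w.count b = w.length := by
  induction w with
  | nil => rfl
  | cons x w ih => cases x <;> simp <;> omega

theorem length_sigma (w : Word) : (sigma w).length = w.length + w.count a := by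
  rw [← count_a_add_count_b, count_a_sigma, count_b_sigma]

theorem length_iterate_sigma (n : ℕ) (w : Word) :
    (sigma^[n] w).length = w.count a * f n + w.count b * f ((n : ℤ) - 1) := by
  have ha : (sigma^[n] [a]).length = f n := by
    rw [← finWord_natCast, length_finWord _ (by omega)]
  have hb : (sigma^[n] [b]).length = f ((n : ℤ) - 1) := by
    rw [← finWord_natCast_sub_one, length_finWord _ (by omega)]
  induction w with
  | nil =>
    have h : sigma^[n] ([] : Word) = [] := Function.iterate_fixed rfl n
    simp [h]
  | cons x w ih =>
    rw [← List.singleton_append, iterate_sigma_append, List.length_append, ih]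
    cases x <;> simp [ha, hb] <;> ring

/-- Desubstitution of the prefixes of a word in the image of `σ`. -/
theorem exists_of_prefix_sigma {v w : Word} (h : w <+: sigma v) :
    (∃ u, u <+: v ∧ w = sigma u) ∨ ∃ u, u ++ [a] <+: v ∧ w = sigma u ++ [a] := by
  induction v generalizing w with
  | nil => exact Or.inl ⟨[], List.prefix_refl _, List.prefix_nil.1 h⟩
  | cons x v ih =>
    have cons_case : ∀ w', w' <+: sigma v → w = sigmaLetter x ++ w' →
        (∃ u, u <+: x :: v ∧ w = sigma u) ∨ ∃ u, u ++ [a] <+: x :: v ∧ w = sigma u ++ [a] := by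
      rintro w' hw' rfl
      rcases ih hw' with ⟨u, hu, rfl⟩ | ⟨u, hu, rfl⟩
      · exact Or.inl ⟨x :: u, by simpa using hu, by simp [sigma]⟩
      · exact Or.inr ⟨x :: u, by simpa using hu, by simp [sigma]⟩
    cases w with
    | nil => exact Or.inl ⟨[], List.nil_prefix, rfl⟩
    | cons y w =>
    cases x
    · have hs : sigma (a :: v) = a :: b :: sigma v := by simp [sigma, sigmaLetter]
      rw [hs, List.cons_prefix_cons] at h
      obtain ⟨rfl, h⟩ := h
      cases w with
      | nil => exact Or.inr ⟨[], by simp, rfl⟩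
      | cons z w =>
      rw [List.cons_prefix_cons] at h
      obtain ⟨rfl, h⟩ := h
      exact cons_case w h rfl
    · have hs : sigma (b :: v) = a :: sigma v := by simp [sigma, sigmaLetter]
      rw [hs, List.cons_prefix_cons] at h
      obtain ⟨rfl, h⟩ := h
      exact cons_case w h rfl

theorem phi_sq : phi * phi = 1 - phi := by
  have h : Real.sqrt 5 * Real.sqrt 5 = 5 := Real.mul_self_sqrt (by norm_num)
  rw [phi]; linarith

theorem phi_pos : 0 < phi := by
  have h : (1 : ℝ) < Real.sqrt 5 := Real.lt_sqrt_of_sq_lt (by norm_num)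
  rw [phi]; linarith

theorem phi_lt_one : phi < 1 := by nlinarith [phi_sq, phi_pos]

/-- The Fibonacci sequence is Sturmian of slope `φ`. -/
theorem IsFibPrefix.count_a_bounds {w : Word} (h : IsFibPrefix w) :
    (w.count a : ℝ) < phi * (w.length + 1) ∧ phi * (w.length + 1) < w.count a + 1 := by
  have hphi := phi_sq
  have hpos := phi_pos
  induction hn : w.length using Nat.strong_induction_on generalizing w with
  | _ n ih =>
  subst hn
  rcases List.eq_nil_or_concat w with rfl | ⟨w₀, x, hw₀⟩
  · simpa using ⟨hpos, phi_lt_one⟩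
  have hne : w ≠ [] := by rw [hw₀]; simp
  obtain ⟨k, hk⟩ := h
  have hk' : w <+: sigma (sigma^[k] [a]) := by
    rw [← Function.iterate_succ_apply' sigma]
    exact hk.trans (iterate_prefix k.le_succ)
  rcases exists_of_prefix_sigma hk' with ⟨u, hu, rfl⟩ | ⟨u, hu, rfl⟩
  -- A nonempty prefix starts with a, so u is strictly shorter than σ(u) and induction applies.
  · have hu0 : 0 < u.count a := by
      obtain ⟨y, u', rfl⟩ := List.exists_cons_of_ne_nil (show u ≠ [] by rintro rfl; exact hne rfl)
      have h1 : [y] = [a] := by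
        have h2 : [y] <+: sigma^[k] [a] := List.IsPrefix.trans ⟨u', rfl⟩ hu
        exact (List.prefix_of_prefix_length_le h2 (iterate_prefix k.zero_le) le_rfl).eq_of_length
          rfl
      obtain rfl : y = a := by simpa using h1
      simp
    obtain ⟨h1, h2⟩ := ih u.length (by rw [length_sigma]; omega) ⟨k, hu⟩ rfl
    -- As φ² = 1 - φ, multiplying each bound for u by φ yields the opposite bound for σ(u).
    rw [count_a_sigma, length_sigma]
    push_cast
    constructor <;> nlinarith
  · have hu' : u <+: sigma^[k] [a] := (List.prefix_append _ _).trans hu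
    obtain ⟨h1, h2⟩ := ih u.length (by
      rw [List.length_append, length_sigma, List.length_singleton]; omega) ⟨k, hu'⟩ rfl
    rw [List.count_append, List.length_append, count_a_sigma, length_sigma]
    simp only [List.count_singleton_self, List.length_singleton]
    push_cast
    constructor <;> nlinarith

theorem count_a_fibFactor (n : ℕ) : (fibFactor 1 n).count a = ⌊phi * ((n + 1 : ℕ) : ℝ)⌋₊ := by
  obtain ⟨h1, h2⟩ := (isFibPrefix_fibFactor n).count_a_bounds
  rw [length_fibFactor_one] at h1 h2
  symm
  rw [Nat.floor_eq_iff (mul_nonneg phi_pos.le (Nat.cast_nonneg _))]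
  push_cast
  exact ⟨h1.le, h2⟩

/-! ### What follows a block boundary. -/

theorem not_bb_infix_sigma (v : Word) : ¬ [b, b] <:+: sigma v := by
  induction v with
  | nil => decide
  | cons x v ih =>
    have hb : ¬ [b] <+: sigma v := by
      cases v with
      | nil => decide
      | cons y v => cases y <;> simp [sigma, sigmaLetter]
    cases x
    · have h : sigma (a :: v) = a :: b :: sigma v := by simp [sigma, sigmaLetter]
      rw [h, List.infix_cons_iff, List.infix_cons_iff]
      simp [List.cons_prefix_cons, ih]
      simpa using hb
    · have h : sigma (b :: v) = a :: sigma v := by simp [sigma, sigmaLetter]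
      rw [h, List.infix_cons_iff]
      simp [List.cons_prefix_cons, ih]

/-- The next two letters of the sequence are aa, ab or ba, never bb; their images abab, aba and aab
begin with aba or aab. -/
theorem isFibPrefix_sigma_append (n : ℕ) :
    IsFibPrefix (sigma (fibFactor 1 n) ++ [a, b, a]) ∨
      IsFibPrefix (sigma (fibFactor 1 n) ++ [a, a, b]) := by
  have h1 : ∃ x y, fibFactor 1 (n + 2) = fibFactor 1 n ++ [x, y] :=
    ⟨fibSeq n, fibSeq (n + 1), by simp [fibFactor, List.range_succ]⟩
  obtain ⟨x, y, h⟩ := h1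
  have h2 := isFibPrefix_fibFactor (n + 2)
  have h3 := h2.iterate_sigma 1
  rw [h] at h2 h3
  rw [Function.iterate_one, sigma_append] at h3
  cases x <;> cases y
  · exact Or.inl (h3.of_prefix ⟨[b], by simp [sigma, sigmaLetter]⟩)
  · exact Or.inl (h3.of_prefix ⟨[], by simp [sigma, sigmaLetter]⟩)
  · exact Or.inr (h3.of_prefix ⟨[], by simp [sigma, sigmaLetter]⟩)
  · obtain ⟨k, hk⟩ := h2
    refine (not_bb_infix_sigma (sigma^[k] [a]) ?_).elim
    rw [← Function.iterate_succ_apply' sigma]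
    exact (List.IsSuffix.isInfix ⟨_, rfl⟩).trans
      (hk.trans (iterate_prefix k.le_succ)).isInfix

/-- `F_{m+1} F_m` and `F_m F_{m+1}` differ only in their last two letters. -/
theorem exists_near_commutation (n : ℕ) : ∃ (c : Word) (x y : Letter),
    sigma^[n] [a, b] = c ++ [x, y] ∧ sigma^[n] [b, a] = c ++ [y, x] := by
  induction n with
  | zero => exact ⟨[], a, b, rfl, rfl⟩
  | succ n ih =>
    obtain ⟨c, x, y, h1, h2⟩ := ih
    -- σ(ab) = a·ba and σ(ba) = a·ab: the common prefix gains σⁿ(a), and the last two letters swap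
    -- roles.
    refine ⟨sigma^[n] [a] ++ c, y, x, ?_, ?_⟩
    · rw [Function.iterate_succ_apply, show sigma [a, b] = [a] ++ [b, a] from rfl,
        iterate_sigma_append, h2, List.append_assoc]
    · rw [Function.iterate_succ_apply, show sigma [b, a] = [a] ++ [a, b] from rfl,
        iterate_sigma_append, h1, List.append_assoc]

/-- By near-commutation, the two words of length f_{n+2} agree except in their last two letters. -/
theorem fibFactor_prefix_iterate_sigma (n l : ℕ) (hl : l + 2 ≤ f ((n : ℤ) + 2)) :
    fibFactor 1 l <+: sigma^[n] [a, b, a] ∧ fibFactor 1 l <+: sigma^[n] [a, a, b] := by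
  obtain ⟨c, x, y, h1, h2⟩ := exists_near_commutation n
  have h3 : sigma^[n] [a, b, a] = sigma^[n] [a] ++ c ++ [y, x] := by
    rw [show [a, b, a] = [a] ++ [b, a] from rfl, iterate_sigma_append, h2, List.append_assoc]
  have h4 : sigma^[n] [a, a, b] = sigma^[n] [a] ++ c ++ [x, y] := by
    rw [show [a, a, b] = [a] ++ [a, b] from rfl, iterate_sigma_append, h1, List.append_assoc]
  have h5 : IsFibPrefix (sigma^[n] [a] ++ c) := by
    have h : IsFibPrefix [a, b, a] := ⟨2, by decide⟩
    exact (h.iterate_sigma n).of_prefix ⟨_, h3.symm⟩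
  have h6 := congrArg List.length h3
  have h7 := f_add_two n (by omega)
  have h8 := f_add_two ((n : ℤ) - 1) (by omega)
  rw [show (n : ℤ) - 1 + 2 = n + 1 by ring, sub_add_cancel] at h8
  rw [length_iterate_sigma, List.length_append] at h6
  simp at h6
  have h9 : fibFactor 1 l <+: sigma^[n] [a] ++ c :=
    (isFibPrefix_fibFactor l).prefix_of_length_le h5 (by
      rw [length_fibFactor_one, List.length_append]; omega)
  rw [h3, h4]
  exact ⟨h9.trans (List.prefix_append _ _), h9.trans (List.prefix_append _ _)⟩

/-! ### Conjugates and the absence of large singular words. -/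

theorem count_eq_of_infix_append_self {g w : Word} (h : w <:+: g ++ g)
    (hw : w.length = g.length) (x : Letter) : w.count x = g.count x := by
  obtain ⟨s, t, h⟩ := h
  have hlen := congrArg List.length h
  simp only [List.length_append] at hlen
  -- A window of length |g| in gg is a rotation of g.
  have h1 : w = g.drop s.length ++ g.take s.length := by
    have h2 : w = (List.drop s.length (s ++ w ++ t)).take g.length := by
      rw [List.append_assoc, List.drop_left, ← hw, List.take_left]
    rw [h, List.drop_append_of_le_length (by omega)] at h2
    rw [h2, List.take_append]
    congr 1
    · exact List.take_of_length_le (by simp)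
    · congr 1
      rw [List.length_drop]; omega
  rw [h1, List.count_append, add_comm, ← List.count_append, List.take_append_drop]

theorem count_eq_of_infix_append_append {g w : Word} (h : w <:+: g ++ (g ++ g))
    (hw : w.length = g.length) (x : Letter) : w.count x = g.count x := by
  obtain ⟨s, t, h⟩ := h
  have hlen := congrArg List.length h
  simp only [List.length_append] at hlen
  rcases le_total s.length g.length with hs | hs
  · refine count_eq_of_infix_append_self ?_ hw x
    have h1 : s ++ w <+: g ++ g := by
      refine List.prefix_of_prefix_length_le (l₃ := s ++ w ++ t) ⟨t, rfl⟩ ?_ ?_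
      · rw [h, ← List.append_assoc]; exact List.prefix_append _ _
      · simp only [List.length_append]; omega
    exact (List.suffix_append s w).isInfix.trans h1.isInfix
  · refine count_eq_of_infix_append_self ?_ hw x
    have h1 : w ++ t <:+ g ++ g := by
      refine List.suffix_of_suffix_length_le (l₃ := s ++ w ++ t) ?_ ?_ ?_
      · rw [List.append_assoc]; exact List.suffix_append _ _
      · rw [h]; exact List.suffix_append _ _
      · simp only [List.length_append]; omega
    exact (List.prefix_append w t).isInfix.trans h1.isInfix

theorem not_singularWord_infix_fibFactor (j : ℤ) (hj : 0 ≤ j) (l : ℕ) (hl : l + 2 ≤ f (j + 2)) :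
    ¬ singularWord j <:+: fibFactor 1 l := by
  intro h
  obtain ⟨n, rfl⟩ := Int.eq_ofNat_of_zero_le hj
  have h1 : fibFactor 1 l <+: finWord n ++ (finWord n ++ finWord n) := by
    cases n with
    -- F_{-1} = b is not a prefix of F_0 = a, so j = 0 is separate; there l ≤ 1.
    | zero =>
      refine ((isFibPrefix_fibFactor l).prefix_of_length_le (isFibPrefix_finWord _ hj) ?_).trans
        (List.prefix_append _ _)
      have h2 : f (((0 : ℕ) : ℤ) + 2) = 3 := rfl
      rw [length_fibFactor_one, length_finWord _ (by omega), Nat.cast_zero, f_zero]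
      omega
    | succ k =>
      -- σʲ(aab) = F_j F_j F_{j-1}, and F_{j-1} is a prefix of F_j for j ≥ 1.
      refine (fibFactor_prefix_iterate_sigma (k + 1) l hl).2.trans ?_
      rw [show [a, a, b] = [a] ++ ([a] ++ [b]) from rfl, iterate_sigma_append,
        iterate_sigma_append, finWord_natCast, List.prefix_append_right_inj,
        List.prefix_append_right_inj, iterate_sigma_b_succ]
      exact iterate_prefix k.le_succ
  have h2 := count_eq_of_infix_append_append (h.trans h1.isInfix)
    (by rw [length_singularWord _ (by omega), length_finWord _ (by omega)]) (lastLetter (n + 1))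
  exact (count_singularWord_lt n (by omega)).ne' h2

theorem le_of_singularWord_infix {m : ℤ} (hm : -1 ≤ m) {w : Word} {l : ℕ}
    (hw : w <:+: fibFactor 1 l) (hl : l + 2 ≤ f (m + 3)) {j : ℤ} (hj : singularWord j <:+: w) :
    j ≤ m := by
  by_contra! h
  exact not_singularWord_infix_fibFactor j (by omega) l
    (hl.trans (f_le_f (by omega))) (hj.trans hw)

theorem exists_isGreatest_singularWord {m : ℤ} (hm : -1 ≤ m) {w : Word} {l : ℕ} (hne : w ≠ [])
    (hw : w <:+: fibFactor 1 l) (hl : l + 2 ≤ f (m + 3)) :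
    ∃ j ≤ m, IsGreatest {l : ℤ | -1 ≤ l ∧ singularWord l <:+: w} j := by
  -- A single letter is already singular: a = K_{-1}, b = K_0.
  have hex : ∃ j : ℤ, -1 ≤ j ∧ singularWord j <:+: w := by
    obtain ⟨x, w', rfl⟩ := List.exists_cons_of_ne_nil hne
    have h : [x] <:+: x :: w' := List.IsPrefix.isInfix ⟨w', rfl⟩
    cases x
    · exact ⟨-1, le_rfl, h⟩
    · exact ⟨0, by omega, h⟩
  have hbd : ∃ j : ℤ, ∀ z : ℤ, (-1 ≤ z ∧ singularWord z <:+: w) → z ≤ j :=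
    ⟨m, fun z hz => le_of_singularWord_infix hm hw hl hz.2⟩
  obtain ⟨j, hj, hmax⟩ := Int.exists_greatest_of_bdd hbd hex
  exact ⟨j, le_of_singularWord_infix hm hw hl hj.2, hj, fun z hz => hmax z hz⟩

theorem ne_nil_of_mem_palindromes {w : Word} (h : w ∈ palindromes) : w ≠ [] := by
  obtain ⟨-, i, j, hi, hij, rfl⟩ := h
  intro h
  have := congrArg List.length h
  simp [fibFactor] at this
  omega

/-! ### Block positions and kernels. -/

/-- The prefix that ends `l` letters after the start of the `(q+1)`-st block `σⁿ(a)` of the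
sequence written as a product of blocks `σⁿ(a)` and `σⁿ(b)`. -/
theorem fibFactor_eq_append (n q l : ℕ) (hl : l + 2 ≤ f ((n : ℤ) + 2)) :
    fibFactor 1 (q * f n + ⌊phi * ((q + 1 : ℕ) : ℝ)⌋₊ * f ((n : ℤ) - 1) + l) =
      sigma^[n] (sigma (fibFactor 1 q)) ++ fibFactor 1 l := by
  have h1 : IsFibPrefix (sigma^[n] (sigma (fibFactor 1 q)) ++ fibFactor 1 l) := by
    obtain ⟨h2, h3⟩ := fibFactor_prefix_iterate_sigma n l hl
    rcases isFibPrefix_sigma_append q with h | h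
    · have h4 := h.iterate_sigma n
      rw [iterate_sigma_append] at h4
      exact h4.of_prefix ((List.prefix_append_right_inj _).2 h2)
    · have h4 := h.iterate_sigma n
      rw [iterate_sigma_append] at h4
      exact h4.of_prefix ((List.prefix_append_right_inj _).2 h3)
  rw [h1.eq_fibFactor, List.length_append, length_iterate_sigma, count_a_sigma, count_b_sigma,
    length_fibFactor_one, length_fibFactor_one, count_a_fibFactor]

theorem singularWord_prefix_cons_fibFactor (m : ℤ) (hm : 0 ≤ m) (l : ℕ) (hl : f m ≤ l + 1) :
    singularWord m <+: lastLetter (m + 1) :: fibFactor 1 l := by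
  rw [singularWord, List.cons_prefix_cons]
  refine ⟨rfl, ((isFibPrefix_finWord m hm).of_prefix
    (List.dropLast_prefix _)).prefix_of_length_le (isFibPrefix_fibFactor l) ?_⟩
  rw [List.length_dropLast, length_finWord m (by omega), length_fibFactor_one]
  omega

/-- A factor that ends with a prefix of the sequence and starts before it, at the boundary of a
block `σⁿ(x)`, contains a singular word `K_j` with `j ≥ n`. -/
theorem exists_singularWord_infix (n : ℕ) (v w : Word) (l : ℕ) (hl : f ((n : ℤ) + 1) ≤ l + 1)
    (hw : w <:+ sigma^[n] v ++ fibFactor 1 l) (hlen : l < w.length) :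
    ∃ j : ℤ, (n : ℤ) ≤ j ∧ singularWord j <:+: w := by
  rcases List.eq_nil_or_concat v with rfl | ⟨v, x, rfl⟩
  · have h : sigma^[n] ([] : Word) = [] := Function.iterate_fixed rfl n
    have := hw.length_le
    rw [h, List.nil_append, length_fibFactor_one] at this
    omega
  have key : ∀ m : ℤ, -1 ≤ m → sigma^[n] [x] = finWord m →
      lastLetter m :: fibFactor 1 l <:+ w := by
    intro m hm h
    rw [List.concat_eq_append, iterate_sigma_append, h, finWord_eq_dropLast_append m hm] at hw
    refine List.suffix_of_suffix_length_le ?_ hw ?_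
    · exact ⟨sigma^[n] v ++ (finWord m).dropLast, by simp⟩
    · rw [List.length_cons, length_fibFactor_one]; omega
  -- The block F_n ends in δ_n = δ_{n+2}, which starts K_{n+1}; the block F_{n-1} ends in δ_{n-1} =
  -- δ_{n+1}, which starts K_n.
  cases x
  · refine ⟨n + 1, by omega, List.IsInfix.trans (List.IsPrefix.isInfix ?_)
      (key n (by omega) (finWord_natCast n).symm).isInfix⟩
    have h := singularWord_prefix_cons_fibFactor (n + 1) (by omega) l hl
    rwa [add_assoc, one_add_one_eq_two, lastLetter_add_two n (by omega)] at h
  · refine ⟨n, le_rfl, List.IsInfix.trans (List.IsPrefix.isInfix ?_)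
      (key (n - 1) (by omega) (finWord_natCast_sub_one n).symm).isInfix⟩
    have h := singularWord_prefix_cons_fibFactor n (by omega) l ((f_le_f (by omega)).trans hl)
    rwa [show (n : ℤ) + 1 = n - 1 + 2 by ring, lastLetter_add_two _ (by omega)] at h

end FibPal

theorem mainTheorem8 (m : ℤ) (hm : -1 ≤ m) (p : ℕ) (hp : 1 ≤ p)
    (i : ℕ) (hi : 1 ≤ i) (hi' : i ≤ FibPal.f (m + 1)) :
    {w : FibPal.Word | w ∈ FibPal.palindromes ∧
        w <:+ FibPal.fibFactor 1 (FibPal.f (m + 2) + i - 2)} =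
      {w : FibPal.Word | w ∈ FibPal.palindromes ∧
        w <:+ FibPal.fibFactor 1
          (p * FibPal.f (m + 1) + (⌊FibPal.phi * (p : ℝ)⌋₊ + 1) * FibPal.f m + i - 2) ∧
        ∃ j : ℤ, -1 ≤ j ∧ j ≤ m ∧ FibPal.IsKernel w (FibPal.singularWord j)} := by
  open FibPal in
  obtain ⟨n, hn⟩ := Int.eq_ofNat_of_zero_le (show 0 ≤ m + 1 by omega)
  obtain ⟨q, rfl⟩ := Nat.exists_eq_add_of_le' hp
  have hf2 := f_add_two m hm
  have hf3 := f_add_two (m + 1) (by omega)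
  have hpos := f_pos m hm
  have hpos' := f_pos (m + 1) (by omega)
  rw [show m + 1 + 2 = m + 3 by ring, show m + 1 + 1 = m + 2 by ring] at hf3
  set l := f (m + 2) + i - 2 with hl
  -- The range of i gives exactly what is needed: i ≥ 1 makes the tail long enough to complete
  -- K_{m+2}, and i ≤ f_{m+1} keeps it short enough to avoid K_{m+1}.
  have hl2 : l + 2 = f (m + 2) + i := by omega
  have hl3 : l + 2 ≤ f (m + 3) := by omega
  have hmn : m = (n : ℤ) - 1 := by omega
  have hdecomp : fibFactor 1 ((q + 1) * f (m + 1) + (⌊phi * ((q + 1 : ℕ) : ℝ)⌋₊ + 1) * f m + i - 2)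
      = sigma^[n] (sigma (fibFactor 1 q)) ++ fibFactor 1 l := by
    have h := fibFactor_eq_append n q l (by
      rwa [show (n : ℤ) + 2 = m + 3 by omega])
    rw [← hmn, ← hn] at h
    rw [← h]
    congr 1
    -- The extra f_{m+1} and f_m add up to the f_{m+2} in l.
    have h1 : (q + 1) * f (m + 1) = q * f (m + 1) + f (m + 1) := by ring
    have h2 : (⌊phi * ((q + 1 : ℕ) : ℝ)⌋₊ + 1) * f m
      = ⌊phi * ((q + 1 : ℕ) : ℝ)⌋₊ * f m + f m := by ring
    omega
  rw [hdecomp]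
  ext w
  constructor
  · rintro ⟨hw, hs⟩
    obtain ⟨j, hj, hmax⟩ :=
      exists_isGreatest_singularWord hm (ne_nil_of_mem_palindromes hw) hs.isInfix hl3
    exact ⟨hw, hs.trans (List.suffix_append _ _), j, hmax.1.1, hj, j, hmax, rfl⟩
  · rintro ⟨hw, hs, j, hj, hjm, j', hmax, heq⟩
    obtain rfl := singularWord_injOn hj hmax.1.1 heq
    refine ⟨hw, List.suffix_of_suffix_length_le hs (List.suffix_append _ _) ?_⟩
    rw [length_fibFactor_one]
    by_contra! hlen
    -- A suffix longer than l would contain K_r with r ≥ n = m + 1, beyond its kernel.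
    obtain ⟨r, hr, hrw⟩ := exists_singularWord_infix n _ w l (by
      rw [show (n : ℤ) + 1 = m + 2 by omega]; omega) hs hlen
    have := hmax.2 ⟨by omega, hrw⟩
    omega
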